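/- Notation: $e(x)=e^{2\pi i x}$, and for a prime $q$ and $n\in\mathbb{Z}$, $\mathrm{Kl}_2(n;q)=q^{-1/2}\sum_{x,y\in\mathbb{F}_q,\ xy=n} e\big(\tfrac{x+y}{q}\big)$. Let $\varepsilon>0$, let $\mathcal{C}=(C_j)_{j\ge 0}$ be a sequence of real numbers and let $B$ be a real number. There is a constant $K$, depending only on $\varepsilon$, $\mathcal{C}$ and $B$, with the following property. Let $q$ be a prime, and let $c>0$, $M,N\ge \tfrac12$ and $Q\ge 1$ be real numbers such that $$\frac{cMN}{(q^{\varepsilon}Q)^2}\ge 1,\qquad M\le N\le Bq,\qquad MN\le Bq,\qquad cN\ge 6 .$$ Let $W_1,W_2,W_3:\mathbb{R}\to\mathbb{R}$ be smooth functions supported in $[0.95,1.05]$ such that $|W_i^{(j)}(x)|\le C_j\,(q^{\varepsilon}Q)^j$ for all $x\ge 0$, all integers $j\ge 0$ and $i=1,2,3$. Let $U\ge 1$ be real, and let $a$ be a natural number with $(a,q)=1$. Then $$\Big|\sum_{m,n\in\mathbb{Z}} W_1\Big(\frac mM\Big)W_2\Big(\frac nN\Big)e(cmn)\,\mathrm{Kl}_2(amn;q)\Big|\le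 K\,(q^{\varepsilon}Q)^2Mq^{1/2}\Big(1+\frac{Q^4}{cM^2N}\Big)$$ and $$\Big|\sum_{m,n\in\mathbb{Z}} W_1\Big(\frac mM\Big)W_2\Big(\frac nN\Big)W_3\Big(\frac{mn}{U}\Big)e(cmn)\,\mathrm{Kl}_2(amn;q)\Big|\le K\,(q^{\varepsilon}Q)^2Mq^{1/2}\Big(1+\frac{Q^4}{cM^2N}\Big).$$ -/

import Mathlib

open scoped ContDiff

noncomputable section

/-- The additive character `e(x) = exp(2πix)` of the real line. -/
def e (x : ℝ) : ℂ := Complex.exp (2 * Real.pi * Complex.I * x)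

/-- The normalised Kloosterman sum `Kl₂(n; q) = q^{-1/2} ∑_{x y = n} e((x + y) / q)`, where `x, y`
range over the residue classes modulo `q`. (`ZMod.stdAddChar` is the character
`x mod q ↦ exp(2πix/q)`.) -/
def Kl₂ (n : ℤ) (q : ℕ) [NeZero q] : ℂ :=
  ((1 / Real.sqrt q : ℝ) : ℂ) *
    ∑ p : ZMod q × ZMod q with p.1 * p.2 = (n : ZMod q), ZMod.stdAddChar (p.1 + p.2)

/-- The condition `(c, q, M, N, Q) ∈ 𝒯₂(ε)`. The number `B` is the constant implied in the two
conditions `N ≪ q` and `M N ≪ q`. -/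
structure MemT₂ (ε B c : ℝ) (q : ℕ) (M N Q : ℝ) : Prop where
  c_pos : 0 < c
  prime : q.Prime
  half_le_M : 1 / 2 ≤ M
  half_le_N : 1 / 2 ≤ N
  one_le_Q : 1 ≤ Q
  one_le : 1 ≤ c * M * N / ((q : ℝ) ^ ε * Q) ^ 2
  M_le_N : M ≤ N
  N_le : N ≤ B * q
  MN_le : M * N ≤ B * q
  six_le : 6 ≤ c * N

/-- `W` is a smooth real function supported in `[0.95, 1.05]` with `|W^{(j)}(x)| ≤ C_j X^j` for all
`x ≥ 0` and `j ≥ 0`. (A function on `[0, ∞)` with this support is extended by zero to `ℝ`.) -/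
structure IsWeight (C : ℕ → ℝ) (X : ℝ) (W : ℝ → ℝ) : Prop where
  smooth : ContDiff ℝ ∞ W
  support : tsupport W ⊆ Set.Icc 0.95 1.05
  bound : ∀ (j : ℕ) (x : ℝ), 0 ≤ x → |iteratedDeriv j W x| ≤ C j * X ^ j

/-- `G(x, y) = W₁(x/M) W₂(y/N) e(cxy)`. -/
def G (c M N : ℝ) (W₁ W₂ : ℝ → ℝ) (x y : ℝ) : ℂ :=
  ((W₁ (x / M) * W₂ (y / N) : ℝ) : ℂ) * e (c * x * y)

/-- `H(x, y) = W₁(x/M) W₂(y/N) W₃(xy/U) e(cxy)`. -/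
def H (c M N U : ℝ) (W₁ W₂ W₃ : ℝ → ℝ) (x y : ℝ) : ℂ :=
  ((W₁ (x / M) * W₂ (y / N) * W₃ (x * y / U) : ℝ) : ℂ) * e (c * x * y)

end

/-! Put X = q^ε Q. For fixed m the phase e(cmn) is linear in n, so it only rotates frequencies.
Opening the Kloosterman sum (`norm_sum_mul_Kl₂_le`) bounds the n-sum by q^{-1/2} ∑_t |∑_n w(n)
z_t^n|, where the q points z_t = e(cm) e(t/q) are equally spaced on the unit circle. Two summations
by parts give |∑_n w(n) z^n| ≪ N / (1 + (N/X)² |1 - z|²), and spacing makes the sum over t at most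
N(4 + qX/N) up to a constant (`norm_smooth_sum_mul_Kl₂_le`). As N ≪ q, each m costs O(X q^{1/2}).

Completion needs q ∤ m; if q ∣ m, then M² ≤ MN ≪ q bounds q, and trivial estimates suffice. Summing
over the O(M) values of m gives X M q^{1/2}, which is stronger than both claims. The weight `W₃` is,
for each m, either another smooth factor in n at scale N/X or incompatible with the support of `W₂`.
-/

/-! ### Sums over equally spaced points of the circle -/

theorem sum_one_div_one_add_sq_le (s : ℝ) (hs : 0 < s) (n : ℕ) :
    ∑ j ∈ Finset.range n, 1 / (1 + (s * j) ^ 2) ≤ 2 + 2 / s := by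
  have key : ∀ n : ℕ, ∑ j ∈ Finset.range (n + 1), 1 / (1 + (s * j) ^ 2)
      ≤ 2 + 2 / s - 2 / s * (1 / (1 + s * n)) := by
    intro n
    induction n with
    | zero => simp
    | succ k ih =>
      rw [Finset.sum_range_succ]
      have hk : (0 : ℝ) ≤ k := k.cast_nonneg
      have h1 : 0 < 1 + s * k := by positivity
      have h2 : 0 < 1 + s * (k + 1) := by positivity
      -- Since (1 + u)² ≤ 2(1 + u²), each term is dominated by a telescoping one.
      have h3 : 1 / (1 + (s * ((k + 1 : ℕ) : ℝ)) ^ 2)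
          ≤ 2 / ((1 + s * k) * (1 + s * (k + 1))) := by
        push_cast
        rw [div_le_div_iff₀ (by positivity) (by positivity)]
        nlinarith [sq_nonneg (s * (k + 1) - 1), mul_pos hs h2]
      have h4 : 2 / ((1 + s * k) * (1 + s * (k + 1)))
          = 2 / s * (1 / (1 + s * k)) - 2 / s * (1 / (1 + s * (k + 1))) := by
        field_simp
        ring
      push_cast at h3 ⊢
      linarith
  refine (Finset.sum_le_sum_of_subset_of_nonneg
    (Finset.range_subset_range.2 n.le_succ) fun _ _ _ => by positivity).trans ((key n).trans ?_)
  have : 0 ≤ 2 / s * (1 / (1 + s * n)) := by positivity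
  linarith

theorem e_add (x y : ℝ) : e (x + y) = e x * e y := by
  simp only [e, ← Complex.exp_add]
  congr 1
  push_cast
  ring

theorem norm_e (x : ℝ) : ‖e x‖ = 1 := by
  have h : e x = Complex.exp ((2 * Real.pi * x : ℝ) * Complex.I) := by
    rw [e]; congr 1; push_cast; ring
  rw [h, Complex.norm_exp_ofReal_mul_I]

theorem e_mul_int (x : ℝ) (n : ℤ) : e (x * n) = e x ^ n := by
  simp only [e, ← Complex.exp_int_mul]
  congr 1
  push_cast
  ring

theorem stdAddChar_intCast_eq_e (q : ℕ) [NeZero q] (k : ℤ) :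
    ZMod.stdAddChar (k : ZMod q) = e (k / q) := by
  rw [ZMod.stdAddChar_coe, e]
  congr 1
  push_cast
  ring

theorem norm_one_sub_e (x : ℝ) : ‖1 - e x‖ = 2 * |Real.sin (Real.pi * x)| := by
  have h : e x = Complex.exp (Complex.I * (2 * Real.pi * x : ℝ)) := by
    rw [e]; congr 1; push_cast; ring
  rw [norm_sub_rev, h, Complex.norm_exp_I_mul_ofReal_sub_one, Real.norm_eq_abs, abs_mul]
  norm_num
  ring_nf

theorem four_mul_le_norm_one_sub_e {x : ℝ} (h0 : 0 ≤ x) (h1 : x ≤ 1 / 2) :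
    4 * x ≤ ‖1 - e x‖ := by
  rw [norm_one_sub_e]
  have hp := Real.pi_pos
  have h := Real.mul_le_sin (x := Real.pi * x) (by positivity) (by nlinarith)
  have h2 : 2 / Real.pi * (Real.pi * x) = 2 * x := by field_simp
  have := le_abs_self (Real.sin (Real.pi * x))
  linarith

theorem four_mul_one_sub_le_norm_one_sub_e {x : ℝ} (h0 : 1 / 2 ≤ x) (h1 : x ≤ 1) :
    4 * (1 - x) ≤ ‖1 - e x‖ := by
  have h := four_mul_le_norm_one_sub_e (x := 1 - x) (by linarith) (by linarith)
  rw [norm_one_sub_e] at h ⊢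
  have h2 : Real.pi * (1 - x) = Real.pi - Real.pi * x := by ring
  rwa [h2, Real.sin_pi_sub] at h

/-- The points `e(δ/q) e(t/q)`, `t mod q`, are `1/q`-spaced on the unit circle. -/
theorem sum_spaced_le_of_mem_Ico (q : ℕ) [NeZero q] {T δ : ℝ} (hT : 0 < T) (h0 : 0 ≤ δ)
    (h1 : δ < 1) :
    ∑ t : ZMod q, 1 / (1 + T ^ 2 * ‖1 - e (δ / q) * ZMod.stdAddChar t‖ ^ 2)
      ≤ 4 + q / T := by
  have hq : (0 : ℝ) < q := Nat.cast_pos.2 (NeZero.pos q)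
  set F : ℕ → ℝ := fun j => 1 / (1 + (4 * T / q * j) ^ 2) with hF
  have h2 : ∑ t : ZMod q, 1 / (1 + T ^ 2 * ‖1 - e (δ / q) * ZMod.stdAddChar t‖ ^ 2)
      = ∑ j ∈ Finset.range q, 1 / (1 + T ^ 2 * ‖1 - e ((j + δ) / q)‖ ^ 2) := by
    symm
    refine Finset.sum_bij (fun j _ => (j : ZMod q)) (fun _ _ => Finset.mem_univ _) ?_ ?_ ?_
    · intro i hi j hj hij
      rw [Finset.mem_range] at hi hj
      have := congrArg ZMod.val hij
      rwa [ZMod.val_cast_of_lt hi, ZMod.val_cast_of_lt hj] at this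
    · intro t _
      exact ⟨t.val, Finset.mem_range.2 t.val_lt, ZMod.natCast_zmod_val t⟩
    · intro j _
      have h := stdAddChar_intCast_eq_e q j
      rw [Int.cast_natCast] at h
      rw [h, ← e_add, ← add_div, add_comm δ, Int.cast_natCast]
  -- The distance to 1 is measured from the nearer end of the arc; as δ < 1, the far end still
  -- leaves (q - 1 - j)/q.
  have h3 : ∀ j ∈ Finset.range q,
      1 / (1 + T ^ 2 * ‖1 - e ((j + δ) / q)‖ ^ 2) ≤ F j + F (q - 1 - j) := by
    intro j hj
    have hj' : j + 1 ≤ q := Finset.mem_range.1 hj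
    have hjq : (j : ℝ) + 1 ≤ q := by exact_mod_cast hj'
    have hFn : ∀ i, 0 ≤ F i := fun i => by positivity
    have mono : ∀ i : ℕ, 4 * (i / q : ℝ) ≤ ‖1 - e ((j + δ) / q)‖ →
        1 / (1 + T ^ 2 * ‖1 - e ((j + δ) / q)‖ ^ 2) ≤ F i := by
      intro i hi
      have hi' : (4 * T / q * i) ^ 2 ≤ T ^ 2 * ‖1 - e ((j + δ) / q)‖ ^ 2 := by
        rw [← mul_pow]
        refine pow_le_pow_left₀ (by positivity) ?_ 2
        calc 4 * T / q * i = T * (4 * (i / q : ℝ)) := by ring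
          _ ≤ _ := by gcongr
      exact one_div_le_one_div_of_le (by positivity) (by linarith)
    rcases le_total ((j + δ) / q) (1 / 2) with hx | hx
    · refine (mono j ((?_ : _ ≤ 4 * ((j + δ) / q)).trans
        (four_mul_le_norm_one_sub_e (by positivity) hx))).trans
        (le_add_of_nonneg_right (hFn _))
      gcongr
      linarith
    · refine (mono (q - 1 - j) ((?_ : _ ≤ 4 * (1 - (j + δ) / q)).trans
        (four_mul_one_sub_le_norm_one_sub_e hx ?_))).trans (le_add_of_nonneg_left (hFn _))
      · have hc : ((q - 1 - j : ℕ) : ℝ) = q - 1 - j := by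
          rw [Nat.cast_sub (by omega), Nat.cast_sub (by omega)]
          simp
        rw [hc, one_sub_div hq.ne']
        refine mul_le_mul_of_nonneg_left (div_le_div_of_nonneg_right ?_ hq.le) (by norm_num)
        linarith
      · rw [div_le_one hq]
        linarith
  rw [h2]
  refine (Finset.sum_le_sum h3).trans ?_
  rw [Finset.sum_add_distrib, Finset.sum_range_reflect F q]
  have h4 := sum_one_div_one_add_sq_le (4 * T / q) (by positivity) q
  have h5 : 2 / (4 * T / q) = q / T / 2 := by
    field_simp
    norm_num
  rw [h5] at h4
  linarith

/-- The integer part of βq merely translates t, so only its fractional part matters. -/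
theorem sum_spaced_le (q : ℕ) [NeZero q] {T : ℝ} (hT : 0 < T) (β : ℝ) :
    ∑ t : ZMod q, 1 / (1 + T ^ 2 * ‖1 - e β * ZMod.stdAddChar t‖ ^ 2) ≤ 4 + q / T := by
  have hq : (0 : ℝ) < q := Nat.cast_pos.2 (NeZero.pos q)
  have h1 : e β = e (Int.fract (β * q) / q) * ZMod.stdAddChar ((⌊β * q⌋ : ℤ) : ZMod q) := by
    rw [stdAddChar_intCast_eq_e, ← e_add, ← add_div, Int.fract_add_floor,
      mul_div_cancel_right₀ _ hq.ne']
  refine le_trans (le_of_eq ?_)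
    (sum_spaced_le_of_mem_Ico q hT (Int.fract_nonneg (β * q)) (Int.fract_lt_one _))
  refine Fintype.sum_equiv (Equiv.addLeft ((⌊β * q⌋ : ℤ) : ZMod q)) _ _ fun t => ?_
  rw [Equiv.coe_addLeft, AddChar.map_add_eq_mul, ← mul_assoc, ← h1]

/-! ### Kloosterman sums and completion -/

theorem Kl₂_eq_sum_erase_zero (q : ℕ) [NeZero q] (hq : q.Prime) (k : ℤ) :
    Kl₂ k q = ((1 / Real.sqrt q : ℝ) : ℂ) *
      ∑ x ∈ (Finset.univ : Finset (ZMod q)).erase 0, ZMod.stdAddChar (x + (k : ZMod q) * x⁻¹) := by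
  have := Fact.mk hq
  rw [Kl₂, Finset.sum_filter, Fintype.sum_prod_type]
  congr 1
  have h0 : ∑ y : ZMod q, ZMod.stdAddChar y = 0 := by
    refine AddChar.sum_eq_zero_of_ne_one fun h => ?_
    have h1 : ZMod.stdAddChar (1 : ZMod q) = ZMod.stdAddChar (0 : ZMod q) := by
      rw [h]; simp
    exact one_ne_zero (ZMod.injective_stdAddChar h1)
  rw [← Finset.add_sum_erase _ _ (Finset.mem_univ (0 : ZMod q))]
  have h1 : ∑ y : ZMod q, (if (0 : ZMod q) * y = k then ZMod.stdAddChar (0 + y) else 0) = 0 := by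
    by_cases hk : (0 : ZMod q) = k
    · simpa [← hk] using h0
    · simp [hk]
  rw [h1, zero_add]
  refine Finset.sum_congr rfl fun x hx => ?_
  have hx0 : x ≠ 0 := Finset.ne_of_mem_erase hx
  rw [Finset.sum_eq_single ((k : ZMod q) * x⁻¹)]
  · rw [if_pos]
    change x * ((k : ZMod q) * x⁻¹) = k
    rw [mul_left_comm, mul_inv_cancel₀ hx0, mul_one]
  · intro y _ hy
    refine if_neg fun (h : x * y = k) => hy ?_
    rw [← h, mul_comm x, mul_assoc, mul_inv_cancel₀ hx0, mul_one]
  · simp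

/-- Completion of a sum against a Kloosterman sum. -/
theorem norm_sum_mul_Kl₂_le (q : ℕ) [NeZero q] (hq : q.Prime) (J : Finset ℤ) (f : ℤ → ℂ) (b : ℤ)
    (hb : (b : ZMod q) ≠ 0) :
    ‖∑ n ∈ J, f n * Kl₂ (b * n) q‖ ≤
      1 / Real.sqrt q * ∑ t : ZMod q, ‖∑ n ∈ J, f n * ZMod.stdAddChar (t * (n : ZMod q))‖ := by
  have := Fact.mk hq
  have h1 : ∀ n : ℤ, Kl₂ (b * n) q = ((1 / Real.sqrt q : ℝ) : ℂ) *
      ∑ t ∈ (Finset.univ : Finset (ZMod q)).erase 0,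
        ZMod.stdAddChar ((b : ZMod q) * t⁻¹) * ZMod.stdAddChar (t * (n : ZMod q)) := by
    intro n
    rw [Kl₂_eq_sum_erase_zero q hq]
    congr 1
    -- The involution x ↦ b/x turns x + bn/x into b/t + tn, so n occurs only in a linear phase.
    refine Finset.sum_nbij' (fun x => (b : ZMod q) * x⁻¹) (fun x => (b : ZMod q) * x⁻¹) ?_ ?_ ?_ ?_ ?_
    · intro x hx
      simpa [hb] using hx
    · intro x hx
      simpa [hb] using hx
    · intro x hx
      have hx0 : x ≠ 0 := Finset.ne_of_mem_erase hx
      field_simp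
    · intro x hx
      have hx0 : x ≠ 0 := Finset.ne_of_mem_erase hx
      field_simp
    · intro x hx
      have hx0 : x ≠ 0 := Finset.ne_of_mem_erase hx
      rw [← AddChar.map_add_eq_mul]
      congr 1
      push_cast
      field_simp
  have h2 : ∑ n ∈ J, f n * Kl₂ (b * n) q = ((1 / Real.sqrt q : ℝ) : ℂ) *
      ∑ t ∈ (Finset.univ : Finset (ZMod q)).erase 0, ZMod.stdAddChar ((b : ZMod q) * t⁻¹) *
        ∑ n ∈ J, f n * ZMod.stdAddChar (t * (n : ZMod q)) := by
    simp_rw [h1, Finset.mul_sum]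
    rw [Finset.sum_comm]
    refine Finset.sum_congr rfl fun t _ => Finset.sum_congr rfl fun n _ => ?_
    ring
  rw [h2, norm_mul, Complex.norm_real, Real.norm_of_nonneg (by positivity)]
  refine mul_le_mul_of_nonneg_left ?_ (by positivity)
  refine (norm_sum_le _ _).trans ((Finset.sum_le_sum fun t _ => ?_).trans
    (Finset.sum_le_sum_of_subset_of_nonneg (Finset.erase_subset _ _) fun _ _ _ => norm_nonneg _))
  rw [norm_mul, AddChar.norm_apply, one_mul]

/-- Trivial bound, needed only when q ∣ m, where q is bounded. -/
theorem norm_Kl₂_le (q : ℕ) [NeZero q] (hq : q.Prime) (k : ℤ) : ‖Kl₂ k q‖ ≤ Real.sqrt q := by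
  rw [Kl₂_eq_sum_erase_zero q hq, norm_mul, Complex.norm_real, Real.norm_of_nonneg (by positivity)]
  have h : ‖∑ x ∈ (Finset.univ : Finset (ZMod q)).erase 0,
      ZMod.stdAddChar (x + (k : ZMod q) * x⁻¹)‖ ≤ q := by
    refine (norm_sum_le _ _).trans ?_
    simp only [AddChar.norm_apply, Finset.sum_const, nsmul_eq_mul, mul_one]
    exact_mod_cast (Finset.card_le_univ _).trans_eq (ZMod.card q)
  calc _ ≤ 1 / Real.sqrt q * q := by gcongr
    _ = _ := by rw [one_div_mul_eq_div, Real.div_sqrt]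

/-! ### Smooth exponential sums by second differences -/

theorem card_Icc_ceil_floor_le {a b : ℝ} (hab : a ≤ b + 1) :
    ((Finset.Icc ⌈a⌉ ⌊b⌋).card : ℝ) ≤ b - a + 1 := by
  rw [Int.card_Icc]
  have h1 := Int.le_ceil a
  have h2 := Int.floor_le b
  rcases le_total 0 (⌊b⌋ + 1 - ⌈a⌉) with h | h
  · have : ((((⌊b⌋ + 1 - ⌈a⌉).toNat : ℕ) : ℤ) : ℝ) = ((⌊b⌋ + 1 - ⌈a⌉ : ℤ) : ℝ) := by
      rw [Int.toNat_of_nonneg h]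
    rw [Int.cast_natCast] at this
    rw [this]
    push_cast
    linarith
  · rw [Int.toNat_of_nonpos h]
    push_cast
    linarith

/-- Two summations by parts. -/
theorem norm_sum_mul_zpow_mul_sq_le (w : ℤ → ℂ) (J J' : Finset ℤ) (D : ℝ)
    (hw : ∀ n, n ∉ J → w n = 0)
    (hJ' : ∀ n, n ∉ J' → n ∉ J ∧ n - 1 ∉ J ∧ n + 1 ∉ J)
    (hD : ∀ n, ‖w (n + 1) - 2 * w n + w (n - 1)‖ ≤ D) (z : ℂ) (hz : ‖z‖ = 1) :
    ‖∑ n ∈ J, w n * z ^ n‖ * ‖1 - z‖ ^ 2 ≤ J'.card * D := by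
  have hz0 : z ≠ 0 := by
    rintro rfl
    simp at hz
  -- `J'` is large enough that shifting by 0 or ±1 loses no term, so a shift by k is multiplication
  -- by z^(-k).
  have hs : ∀ k : ℤ, (∀ n, n ∉ J' → n + k ∉ J) →
      ∑ n ∈ J', w (n + k) * z ^ n = z ^ (-k) * ∑ n ∈ J, w n * z ^ n := by
    intro k hk
    have h1 : ∑ n ∈ J', w (n + k) * z ^ n = ∑' n : ℤ, w (n + k) * z ^ n :=
      (tsum_eq_sum fun n hn => by rw [hw _ (hk n hn), zero_mul]).symm
    have h2 : ∑ n ∈ J, w n * z ^ n = ∑' n : ℤ, w n * z ^ n :=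
      (tsum_eq_sum fun n hn => by rw [hw _ hn, zero_mul]).symm
    rw [h1, h2, ← tsum_mul_left, ← (Equiv.addRight k).tsum_eq (fun n => z ^ (-k) * (w n * z ^ n))]
    refine tsum_congr fun n => ?_
    rw [Equiv.coe_addRight, zpow_add₀ hz0, zpow_neg]
    field_simp
  have h0 := hs 0 fun n hn => by simpa using (hJ' n hn).1
  have h1 := hs 1 fun n hn => (hJ' n hn).2.2
  have h2 := hs (-1) fun n hn => (hJ' n hn).2.1
  -- The second difference contributes z⁻¹ - 2 + z = z⁻¹(1 - z)².
  have key : ∑ n ∈ J', (w (n + 1) - 2 * w n + w (n - 1)) * z ^ n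
      = z⁻¹ * (1 - z) ^ 2 * ∑ n ∈ J, w n * z ^ n := by
    have h3 : ∑ n ∈ J', (w (n + 1) - 2 * w n + w (n - 1)) * z ^ n
        = ∑ n ∈ J', w (n + 1) * z ^ n - 2 * ∑ n ∈ J', w (n + 0) * z ^ n
          + ∑ n ∈ J', w (n + -1) * z ^ n := by
      rw [Finset.mul_sum, ← Finset.sum_sub_distrib, ← Finset.sum_add_distrib]
      refine Finset.sum_congr rfl fun n _ => ?_
      rw [add_zero, ← sub_eq_add_neg]
      ring
    rw [h3, h0, h1, h2]
    simp only [neg_zero, zpow_zero, neg_neg, zpow_one, zpow_neg]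
    field_simp
    ring
  have h4 : ‖∑ n ∈ J, w n * z ^ n‖ * ‖1 - z‖ ^ 2
      = ‖∑ n ∈ J', (w (n + 1) - 2 * w n + w (n - 1)) * z ^ n‖ := by
    rw [key, norm_mul, norm_mul, norm_inv, hz, norm_pow, inv_one, one_mul, mul_comm]
  rw [h4]
  refine (norm_sum_le _ _).trans ?_
  rw [← nsmul_eq_mul]
  refine Finset.sum_le_card_nsmul _ _ _ fun n _ => ?_
  rw [norm_mul, norm_zpow, hz, one_zpow, mul_one]
  exact hD n

/-- The mean value inequality applied twice, each time over an interval of length 1. -/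
theorem abs_second_difference_le {w w1 w2 : ℝ → ℝ} {D : ℝ} (h1 : ∀ x, HasDerivAt w (w1 x) x)
    (h2 : ∀ x, HasDerivAt w1 (w2 x) x) (hD : ∀ x, |w2 x| ≤ D) (x : ℝ) :
    |w (x + 1) - 2 * w x + w (x - 1)| ≤ D := by
  have hw1 : ∀ y, |w1 (y + 1) - w1 y| ≤ D := by
    intro y
    have := Convex.norm_image_sub_le_of_norm_hasDerivWithin_le (f := w1) (f' := w2) (C := D)
      (s := Set.univ) (fun x _ => (h2 x).hasDerivWithinAt) (fun x _ => hD x) convex_univ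
      (Set.mem_univ y) (Set.mem_univ (y + 1))
    simpa using this
  have h3 : ∀ y, HasDerivAt (fun y => w (y + 1) - w y) (w1 (y + 1) - w1 y) y := fun y =>
    ((h1 (y + 1)).comp_add_const y 1).sub (h1 y)
  have := Convex.norm_image_sub_le_of_norm_hasDerivWithin_le (f := fun y => w (y + 1) - w y)
    (f' := fun y => w1 (y + 1) - w1 y) (C := D)
    (s := Set.univ) (fun x _ => (h3 x).hasDerivWithinAt) (fun x _ => hw1 x) convex_univ
    (Set.mem_univ (x - 1)) (Set.mem_univ x)
  simp only [sub_add_cancel, Real.norm_eq_abs, sub_sub_cancel, abs_one, mul_one] at this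
  convert this using 2
  ring

/-- The smooth sum over `n ∼ N` of a twisted Kloosterman sum. -/
theorem norm_smooth_sum_mul_Kl₂_le (q : ℕ) [NeZero q] (hq : q.Prime) {N X A : ℝ} (hN : 1 / 2 ≤ N)
    (hX : 1 ≤ X) (w w1 w2 : ℝ → ℝ)
    (hsupp : ∀ x, x ∉ Set.Icc (0.95 * N) (1.05 * N) → w x = 0) (hA : ∀ x, |w x| ≤ A)
    (h1 : ∀ x, HasDerivAt w (w1 x) x) (h2 : ∀ x, HasDerivAt w1 (w2 x) x)
    (hD : ∀ x, |w2 x| ≤ A * (X / N) ^ 2) (β : ℝ) (b : ℤ) (hb : (b : ZMod q) ≠ 0) :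
    ‖∑ n ∈ Finset.Icc ⌈0.95 * N⌉ ⌊1.05 * N⌋, ((w n : ℝ) : ℂ) * e (β * n) * Kl₂ (b * n) q‖
      ≤ 10 * N * A * (4 + q * X / N) / Real.sqrt q := by
  have hN0 : 0 < N := by linarith
  have hX0 : 0 < X := by linarith
  have hA0 : 0 ≤ A := (abs_nonneg _).trans (hA 0)
  set J := Finset.Icc ⌈0.95 * N⌉ ⌊1.05 * N⌋ with hJ
  set J' := Finset.Icc ⌈0.95 * N - 1⌉ ⌊1.05 * N + 1⌋ with hJ'
  have hJc : (J.card : ℝ) ≤ 3 * N := by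
    refine (card_Icc_ceil_floor_le (by linarith)).trans ?_
    linarith
  have hJc' : (J'.card : ℝ) ≤ 7 * N := by
    refine (card_Icc_ceil_floor_le (by linarith)).trans ?_
    linarith
  have hmem : ∀ n : ℤ, n ∈ J ↔ 0.95 * N ≤ n ∧ (n : ℝ) ≤ 1.05 * N := fun n => by
    rw [hJ, Finset.mem_Icc, Int.ceil_le, Int.le_floor]
  have hmem' : ∀ n : ℤ, n ∈ J' ↔ 0.95 * N - 1 ≤ n ∧ (n : ℝ) ≤ 1.05 * N + 1 := fun n => by
    rw [hJ', Finset.mem_Icc, Int.ceil_le, Int.le_floor]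
  -- The constant 10 = 3 + 7 adds the trivial bound (from `J`) to the second-difference bound (from
  -- `J'`).
  have hS : ∀ z : ℂ, ‖z‖ = 1 → ‖∑ n ∈ J, ((w n : ℝ) : ℂ) * z ^ n‖
      ≤ 10 * N * A * (1 / (1 + (N / X) ^ 2 * ‖1 - z‖ ^ 2)) := by
    intro z hz
    have hb1 : ‖∑ n ∈ J, ((w n : ℝ) : ℂ) * z ^ n‖ ≤ 3 * N * A := by
      refine (norm_sum_le _ _).trans ((Finset.sum_le_card_nsmul _ _ A fun n _ => ?_).trans ?_)
      · rw [norm_mul, norm_zpow, hz, one_zpow, mul_one, Complex.norm_real]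
        exact hA n
      · rw [nsmul_eq_mul]
        gcongr
    have hb2 : ‖∑ n ∈ J, ((w n : ℝ) : ℂ) * z ^ n‖ * ‖1 - z‖ ^ 2
        ≤ 7 * N * (A * (X / N) ^ 2) := by
      refine (norm_sum_mul_zpow_mul_sq_le (fun n => ((w n : ℝ) : ℂ)) J J' (A * (X / N) ^ 2)
        ?_ ?_ ?_ z hz).trans ?_
      · intro n hn
        rw [hmem] at hn
        simp [hsupp n hn]
      · intro n hn
        rw [hmem'] at hn
        refine ⟨fun h => hn ?_, fun h => hn ?_, fun h => hn ?_⟩ <;> rw [hmem] at h <;>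
          push_cast at h <;> constructor <;> linarith [h.1, h.2]
      · intro n
        have := abs_second_difference_le h1 h2 hD n
        rw [← Real.norm_eq_abs, ← Complex.norm_real] at this
        push_cast at this ⊢
        exact this
      · gcongr
    have hb3 : ‖∑ n ∈ J, ((w n : ℝ) : ℂ) * z ^ n‖ * ((N / X) ^ 2 * ‖1 - z‖ ^ 2) ≤ 7 * N * A := by
      calc _ = (N / X) ^ 2 * (‖∑ n ∈ J, ((w n : ℝ) : ℂ) * z ^ n‖ * ‖1 - z‖ ^ 2) := by ring
        _ ≤ (N / X) ^ 2 * (7 * N * (A * (X / N) ^ 2)) := by gcongr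
        _ = 7 * N * A := by field_simp
    rw [mul_one_div, le_div_iff₀ (by positivity)]
    linarith
  simp_rw [mul_assoc]
  simp_rw [← mul_assoc]
  refine (norm_sum_mul_Kl₂_le q hq J (fun n => ((w n : ℝ) : ℂ) * e (β * n)) b hb).trans ?_
  rw [one_div_mul_eq_div]
  refine div_le_div_of_nonneg_right ?_ (Real.sqrt_nonneg _)
  have hz : ∀ t : ZMod q, ‖∑ n ∈ J, ((w n : ℝ) : ℂ) * e (β * n) *
      ZMod.stdAddChar (t * (n : ZMod q))‖ ≤
      10 * N * A * (1 / (1 + (N / X) ^ 2 * ‖1 - e β * ZMod.stdAddChar t‖ ^ 2)) := by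
    intro t
    refine le_trans (le_of_eq ?_) (hS (e β * ZMod.stdAddChar t) ?_)
    · congr 1
      refine Finset.sum_congr rfl fun n _ => ?_
      rw [e_mul_int, mul_zpow, mul_assoc, mul_comm t, ← zsmul_eq_mul, AddChar.map_zsmul_eq_zpow]
    · rw [norm_mul, norm_e, AddChar.norm_apply, one_mul]
  refine (Finset.sum_le_sum fun t _ => hz t).trans ?_
  rw [← Finset.mul_sum]
  refine mul_le_mul_of_nonneg_left ((sum_spaced_le q (T := N / X) (by positivity) β).trans_eq ?_)
    (by positivity)
  field_simp

/-! ### Derivative bounds for weights -/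

namespace IsWeight

variable {C : ℕ → ℝ} {X : ℝ} {W : ℝ → ℝ}

theorem eq_zero_of_notMem (h : IsWeight C X W) {x : ℝ} (hx : x ∉ Set.Icc (0.95 : ℝ) 1.05) :
    W x = 0 :=
  image_eq_zero_of_notMem_tsupport fun h' => hx (h.support h')

theorem hasDerivAt (h : IsWeight C X W) (x : ℝ) : HasDerivAt W (deriv W x) x :=
  (h.smooth.differentiable (by simp) x).hasDerivAt

theorem hasDerivAt_deriv (h : IsWeight C X W) (x : ℝ) :
    HasDerivAt (deriv W) (deriv (deriv W) x) x := by
  have h1 : Differentiable ℝ (iteratedDeriv 1 W) :=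
    h.smooth.differentiable_iteratedDeriv 1 (by exact_mod_cast WithTop.coe_lt_top _)
  rw [iteratedDeriv_one] at h1
  exact (h1 x).hasDerivAt

/-- For negative x, outside the support, all derivatives vanish. -/
theorem abs_iteratedDeriv_le (h : IsWeight C X W) (hX : 0 ≤ X) (j : ℕ) (x : ℝ) :
    |iteratedDeriv j W x| ≤ |C j| * X ^ j := by
  rcases le_or_gt 0 x with hx | hx
  · exact (h.bound j x hx).trans (by gcongr; exact le_abs_self _)
  · have h1 : iteratedFDeriv ℝ j W x = 0 := by
      refine image_eq_zero_of_notMem_tsupport fun h' => ?_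
      have := (h.support (tsupport_iteratedFDeriv_subset j h')).1
      linarith
    rw [iteratedDeriv, h1]
    simp only [_root_.zero_apply, abs_zero]
    positivity

end IsWeight

/-- A common bound for the first three constants of a family of weights. -/
def weightConst (C : ℕ → ℝ) : ℝ := 1 + |C 0| + |C 1| + |C 2|

theorem one_le_weightConst (C : ℕ → ℝ) : 1 ≤ weightConst C := by
  unfold weightConst
  linarith [abs_nonneg (C 0), abs_nonneg (C 1), abs_nonneg (C 2)]

namespace IsWeight

variable {C : ℕ → ℝ} {X : ℝ} {W : ℝ → ℝ}

theorem abs_le (h : IsWeight C X W) (hX : 0 ≤ X) (x : ℝ) : |W x| ≤ weightConst C := by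
  have h1 := h.abs_iteratedDeriv_le hX 0 x
  rw [iteratedDeriv_zero, pow_zero, mul_one] at h1
  unfold weightConst
  linarith [abs_nonneg (C 1), abs_nonneg (C 2)]

theorem abs_deriv_le (h : IsWeight C X W) (hX : 0 ≤ X) (x : ℝ) :
    |deriv W x| ≤ weightConst C * X := by
  have h1 := h.abs_iteratedDeriv_le hX 1 x
  rw [iteratedDeriv_one, pow_one] at h1
  refine h1.trans (mul_le_mul_of_nonneg_right ?_ hX)
  unfold weightConst
  linarith [abs_nonneg (C 0), abs_nonneg (C 2)]

theorem abs_deriv_deriv_le (h : IsWeight C X W) (hX : 0 ≤ X) (x : ℝ) :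
    |deriv (deriv W) x| ≤ weightConst C * X ^ 2 := by
  have h1 := h.abs_iteratedDeriv_le hX 2 x
  rw [iteratedDeriv_succ, iteratedDeriv_one] at h1
  refine h1.trans (mul_le_mul_of_nonneg_right ?_ (sq_nonneg X))
  unfold weightConst
  linarith [abs_nonneg (C 0), abs_nonneg (C 1)]

end IsWeight

/-- `V` and its first two derivatives are bounded by `L`, `L Y`, `L Y²`. -/
def HasDerivBounds (L Y : ℝ) (V : ℝ → ℝ) : Prop :=
  ∃ V1 V2 : ℝ → ℝ, (∀ x, HasDerivAt V (V1 x) x) ∧ (∀ x, HasDerivAt V1 (V2 x) x) ∧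
    (∀ x, |V x| ≤ L) ∧ (∀ x, |V1 x| ≤ L * Y) ∧ ∀ x, |V2 x| ≤ L * Y ^ 2

theorem HasDerivBounds.mono {L Y Y' : ℝ} {V : ℝ → ℝ} (h : HasDerivBounds L Y V) (hY : 0 ≤ Y)
    (hYY' : Y ≤ Y') : HasDerivBounds L Y' V := by
  obtain ⟨V1, V2, h1, h2, b0, b1, b2⟩ := h
  have hL : 0 ≤ L := (abs_nonneg _).trans (b0 0)
  exact ⟨V1, V2, h1, h2, b0, fun x => (b1 x).trans (by gcongr), fun x => (b2 x).trans (by gcongr)⟩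

theorem hasDerivBounds_const_one {L Y : ℝ} (hL : 1 ≤ L) (hY : 0 ≤ Y) :
    HasDerivBounds L Y fun _ => 1 := by
  refine ⟨fun _ => 0, fun _ => 0, fun x => hasDerivAt_const x 1, fun x => hasDerivAt_const x 0,
    fun x => by simpa using hL, fun x => ?_, fun x => ?_⟩ <;> rw [abs_zero] <;> positivity

theorem IsWeight.hasDerivBounds_comp_mul {C : ℕ → ℝ} {X : ℝ} {W : ℝ → ℝ} (h : IsWeight C X W)
    (hX : 0 ≤ X) {k : ℝ} (hk : 0 ≤ k) :
    HasDerivBounds (weightConst C) (X * k) fun x => W (k * x) := by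
  have hd : ∀ (f f' : ℝ → ℝ) (_ : ∀ x, HasDerivAt f (f' x) x) (x : ℝ),
      HasDerivAt (fun x => f (k * x)) (f' (k * x) * k) x := fun f f' hf x => by
    have h1 : HasDerivAt (fun x => k * x) k x := by simpa using (hasDerivAt_id x).const_mul k
    exact (hf (k * x)).comp x h1
  refine ⟨fun x => deriv W (k * x) * k, fun x => deriv (deriv W) (k * x) * k * k,
    hd _ _ h.hasDerivAt, fun x => (hd _ _ h.hasDerivAt_deriv x).mul_const k,
    fun x => h.abs_le hX _, fun x => ?_, fun x => ?_⟩
  · rw [abs_mul, abs_of_nonneg hk, ← mul_assoc]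
    exact mul_le_mul_of_nonneg_right (h.abs_deriv_le hX _) hk
  · rw [abs_mul, abs_mul, abs_of_nonneg hk]
    calc _ ≤ weightConst C * X ^ 2 * k * k := by
          gcongr
          exact h.abs_deriv_deriv_le hX _
      _ = _ := by ring

/-- Leibniz yields 2^j terms of size L L' Y^j, absorbed by doubling Y. -/
theorem HasDerivBounds.mul {L L' Y : ℝ} {V V' : ℝ → ℝ} (h : HasDerivBounds L Y V)
    (h' : HasDerivBounds L' Y V') : HasDerivBounds (L * L') (2 * Y) fun x => V x * V' x := by
  obtain ⟨V1, V2, h1, h2, b0, b1, b2⟩ := h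
  obtain ⟨V1', V2', h1', h2', b0', b1', b2'⟩ := h'
  have hL : 0 ≤ L := (abs_nonneg _).trans (b0 0)
  have hL' : 0 ≤ L' := (abs_nonneg _).trans (b0' 0)
  have hm : ∀ {x y a b : ℝ}, |x| ≤ a → |y| ≤ b → |x * y| ≤ a * b := fun {x y a b} hx hy => by
    rw [abs_mul]
    exact mul_le_mul hx hy (abs_nonneg _) ((abs_nonneg _).trans hx)
  refine ⟨fun x => V1 x * V' x + V x * V1' x,
    fun x => (V2 x * V' x + V1 x * V1' x) + (V1 x * V1' x + V x * V2' x),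
    fun x => (h1 x).mul (h1' x),
    fun x => ((h2 x).mul (h1' x)).add ((h1 x).mul (h2' x)),
    fun x => hm (b0 x) (b0' x), fun x => ?_, fun x => ?_⟩
  · refine (abs_add_le _ _).trans
      ((add_le_add (hm (b1 x) (b0' x)) (hm (b0 x) (b1' x))).trans_eq ?_)
    ring
  · refine (abs_add_le _ _).trans ((add_le_add
      ((abs_add_le _ _).trans (add_le_add (hm (b2 x) (b0' x)) (hm (b1 x) (b1' x))))
      ((abs_add_le _ _).trans (add_le_add (hm (b1 x) (b1' x)) (hm (b0 x) (b2' x))))).trans_eq ?_)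
    ring

/-- The sum over n for one m: v stands for `W₁ (m / M)` and V for the third weight. The product has
scale 4X/N, whence 16 = 4². -/
theorem norm_weighted_sum_mul_Kl₂_le (q : ℕ) [NeZero q] (hq : q.Prime) {N X : ℝ}
    (hN : 1 / 2 ≤ N) (hX : 1 ≤ X) {C : ℕ → ℝ} {W V : ℝ → ℝ} (hW : IsWeight C X W)
    (hV : HasDerivBounds (weightConst C) (2 * (X / N)) V) {v : ℝ} (hv : |v| ≤ weightConst C)
    (β : ℝ) (b : ℤ) (hb : (b : ZMod q) ≠ 0) :
    ‖∑ n ∈ Finset.Icc ⌈0.95 * N⌉ ⌊1.05 * N⌋,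
        ((v * W (n / N) * V n : ℝ) : ℂ) * e (β * n) * Kl₂ (b * n) q‖
      ≤ 10 * N * (16 * weightConst C ^ 3) * (4 + q * X / N) / Real.sqrt q := by
  have hN0 : 0 < N := by linarith
  have hX0 : 0 < X := by linarith
  have hL := one_le_weightConst C
  have hd1 := (hW.hasDerivBounds_comp_mul hX0.le (k := N⁻¹) (by positivity)).mono
    (Y' := 2 * (X / N)) (by positivity) (by
      rw [← div_eq_mul_inv]
      have : 0 ≤ X / N := by positivity
      linarith)
  obtain ⟨w1, w2, h1, h2, b0, -, b2⟩ := hd1.mul hV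
  refine norm_smooth_sum_mul_Kl₂_le q hq hN hX (fun x => v * W (x / N) * V x)
    (fun x => v * w1 x) (fun x => v * w2 x) ?_ ?_ ?_ ?_ ?_ β b hb
  · intro x hx
    rw [hW.eq_zero_of_notMem, mul_zero, zero_mul]
    rintro ⟨h3, h4⟩
    exact hx ⟨(le_div_iff₀ hN0).1 h3, (div_le_iff₀ hN0).1 h4⟩
  · intro x
    have h3 : |W (N⁻¹ * x) * V x| ≤ _ := b0 x
    rw [inv_mul_eq_div] at h3
    rw [mul_assoc, abs_mul]
    calc _ ≤ weightConst C * (weightConst C * weightConst C) := by gcongr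
      _ = weightConst C ^ 3 := by ring
      _ ≤ _ := by linarith [pow_pos (zero_lt_one.trans_le hL) 3]
  · intro x
    refine ((h1 x).const_mul v).congr_of_eventuallyEq (Filter.Eventually.of_forall fun y => ?_)
    simp only [inv_mul_eq_div, mul_assoc]
  · exact fun x => (h2 x).const_mul v
  · intro x
    rw [abs_mul]
    calc _ ≤ weightConst C * (weightConst C * weightConst C * (2 * (2 * (X / N))) ^ 2) := by
          gcongr
          exact b2 x
      _ = _ := by ring

/-! ### Summation over m and the two estimates -/

theorem norm_tsum_prod_le {F : ℤ × ℤ → ℂ} (I J : Finset ℤ) {E : ℝ}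
    (hF : ∀ m n, ¬(m ∈ I ∧ n ∈ J) → F (m, n) = 0)
    (hE : ∀ m ∈ I, ‖∑ n ∈ J, F (m, n)‖ ≤ E) : ‖∑' p, F p‖ ≤ I.card * E := by
  rw [tsum_eq_sum (s := I ×ˢ J) fun p hp => hF p.1 p.2 fun h => hp (Finset.mem_product.2 h),
    Finset.sum_product, ← nsmul_eq_mul]
  exact (norm_sum_le _ _).trans (Finset.sum_le_card_nsmul _ _ _ hE)

/-- The implied constant. -/
def implicitConst (C : ℕ → ℝ) (B : ℝ) : ℝ :=
  3 * (weightConst C ^ 3 * (160 * (4 * B + 1) + 6 * B ^ 2))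

/-- Treats both sums at once: V is 1 or `W₃ (x * y / U)`. The alternative in `hV` discards those m
whose terms all vanish. -/
theorem norm_tsum_weighted_mul_Kl₂_le {ε : ℝ} (hε : 0 < ε) {C : ℕ → ℝ} {B c : ℝ} {q : ℕ} [NeZero q]
    {M N Q : ℝ} (h : MemT₂ ε B c q M N Q) {W₁ W₂ : ℝ → ℝ}
    (hW₁ : IsWeight C ((q : ℝ) ^ ε * Q) W₁) (hW₂ : IsWeight C ((q : ℝ) ^ ε * Q) W₂)
    {a : ℕ} (ha : a.Coprime q) (V : ℝ → ℝ → ℝ)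
    (hV : ∀ x, 0 < x → (∀ y, W₂ (y / N) * V x y = 0) ∨
      HasDerivBounds (weightConst C) (2 * ((q : ℝ) ^ ε * Q / N)) (V x)) :
    ‖∑' p : ℤ × ℤ, ((W₁ (p.1 / M) * W₂ (p.2 / N) * V p.1 p.2 : ℝ) : ℂ) * e (c * p.1 * p.2) *
        Kl₂ (a * p.1 * p.2) q‖
      ≤ implicitConst C B * (((q : ℝ) ^ ε * Q) ^ 2 * M * (q : ℝ) ^ (1 / 2 : ℝ) *
                (1 + Q ^ 4 / (c * M ^ 2 * N))) := by
  have := Fact.mk h.prime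
  obtain ⟨hc, hq, hM, hN, hQ, -, hMN, hNq, hMNq, -⟩ := h
  have hq1 : (1 : ℝ) ≤ q := by exact_mod_cast hq.one_lt.le
  have hq0 : (0 : ℝ) < q := by linarith
  have hN0 : 0 < N := by linarith
  have hM0 : 0 < M := by linarith
  have hX : 1 ≤ (q : ℝ) ^ ε * Q := one_le_mul_of_one_le_of_one_le (Real.one_le_rpow hq1 hε.le) hQ
  set X := (q : ℝ) ^ ε * Q with hXdef
  have hB : 0 < B := by
    by_contra! hB
    nlinarith
  set L := weightConst C with hLdef
  have hL : 1 ≤ L := one_le_weightConst C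
  set r := Real.sqrt q with hr
  have hr0 : 0 < r := Real.sqrt_pos.2 hq0
  have hrr : r * r = q := Real.mul_self_sqrt hq0.le
  set I := Finset.Icc ⌈0.95 * M⌉ ⌊1.05 * M⌋ with hI
  set J := Finset.Icc ⌈0.95 * N⌉ ⌊1.05 * N⌋ with hJ
  have hIc : (I.card : ℝ) ≤ 3 * M := by
    refine (card_Icc_ceil_floor_le (by linarith)).trans ?_
    linarith
  have hJc : (J.card : ℝ) ≤ 3 * N := by
    refine (card_Icc_ceil_floor_le (by linarith)).trans ?_
    linarith
  have hmem : ∀ {W : ℝ → ℝ} (_ : IsWeight C X W) {R : ℝ} (_ : 0 < R) (m : ℤ),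
      m ∉ Finset.Icc ⌈0.95 * R⌉ ⌊1.05 * R⌋ → W (m / R) = 0 := by
    intro W hW R hR m hm
    refine hW.eq_zero_of_notMem fun h => hm ?_
    rw [Finset.mem_Icc, Int.ceil_le, Int.le_floor]
    exact ⟨(le_div_iff₀ hR).1 h.1, (div_le_iff₀ hR).1 h.2⟩
  set E := L ^ 3 * (160 * (4 * B + 1) + 6 * B ^ 2) * (X * r) with hE
  have hE0 : 0 ≤ E := by positivity
  have key : ∀ m ∈ I, ‖∑ n ∈ J, ((W₁ (m / M) * W₂ (n / N) * V m n : ℝ) : ℂ) * e (c * m * n) *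
        Kl₂ (a * m * n) q‖ ≤ E := by
    intro m hm
    rw [hI, Finset.mem_Icc, Int.ceil_le, Int.le_floor] at hm
    rcases hV m (by linarith [hm.1]) with h0 | hVm
    · refine le_of_eq_of_le ?_ hE0
      rw [norm_eq_zero]
      refine Finset.sum_eq_zero fun n _ => ?_
      rw [mul_assoc (W₁ _), h0, mul_zero, Complex.ofReal_zero, zero_mul, zero_mul]
    by_cases hb : ((a * m : ℤ) : ZMod q) = 0
    · have hmz : (q : ℤ) ∣ m := by
        rw [ZMod.intCast_zmod_eq_zero_iff_dvd] at hb
        exact (Nat.isCoprime_iff_coprime.2 ha).symm.dvd_of_dvd_mul_left hb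
      have hqm : (q : ℝ) ≤ m := by
        exact_mod_cast Int.le_of_dvd (by exact_mod_cast (by linarith [hm.1] : (0 : ℝ) < m)) hmz
      -- From q ≤ m ≤ 1.05M and M² ≤ MN ≤ Bq follows q ≤ 1.05² B.
      have hq2B : (q : ℝ) ≤ 2 * B := by
        by_contra! hlt
        nlinarith [hm.2]
      have h1 : ∀ n ∈ J, ‖((W₁ (m / M) * W₂ (n / N) * V m n : ℝ) : ℂ) * e (c * m * n) *
          Kl₂ (a * m * n) q‖ ≤ L * L * L * r := by
        intro n _
        rw [norm_mul, norm_mul, norm_e, mul_one, Complex.norm_real, norm_mul, norm_mul]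
        obtain ⟨V1, V2, -, -, b0, -, -⟩ := hVm
        gcongr
        · exact hW₁.abs_le (by linarith) _
        · exact hW₂.abs_le (by linarith) _
        · exact b0 _
        · exact norm_Kl₂_le q hq _
      refine (norm_sum_le _ _).trans ((Finset.sum_le_card_nsmul _ _ _ h1).trans ?_)
      rw [nsmul_eq_mul]
      -- Here N ≤ Bq ≤ 2B², which accounts for 6B² in the constant.
      have h2 : 3 * N ≤ (160 * (4 * B + 1) + 6 * B ^ 2) * X := by
        nlinarith [mul_le_mul_of_nonneg_left hq2B hB.le]
      calc (J.card : ℝ) * (L * L * L * r) ≤ (160 * (4 * B + 1) + 6 * B ^ 2) * X *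
            (L * L * L * r) := by
            gcongr
            exact hJc.trans h2
        _ = E := by rw [hE]; ring
    · have h1 := norm_weighted_sum_mul_Kl₂_le q hq hN hX hW₂ hVm
        (hW₁.abs_le (by linarith) (m / M)) (c * m) (a * m) hb
      refine h1.trans ?_
      rw [div_le_iff₀ hr0]
      have h2 : 10 * N * (16 * L ^ 3) * (4 + q * X / N) = 160 * L ^ 3 * (4 * N + q * X) := by
        field_simp
        norm_num
      have h3 : E * r = L ^ 3 * (160 * (4 * B + 1) + 6 * B ^ 2) * (X * q) := by
        rw [hE, ← hrr]; ring
      rw [h2, h3]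
      have h4 : N ≤ B * q * X := hNq.trans (le_mul_of_one_le_right (by positivity) hX)
      calc _ ≤ 160 * L ^ 3 * (4 * (B * q * X) + q * X) := by gcongr
        _ = L ^ 3 * (160 * (4 * B + 1) + 0) * (X * q) := by ring
        _ ≤ _ := by gcongr; positivity
  refine (norm_tsum_prod_le I J (E := E) ?_ key).trans ?_
  · intro m n hmn
    rw [not_and_or] at hmn
    rcases hmn with hm | hn
    · simp [hmem hW₁ hM0 m hm]
    · simp [hmem hW₂ hN0 n hn]
  · rw [← Real.sqrt_eq_rpow, ← hr]
    have hK : 0 ≤ L ^ 3 * (160 * (4 * B + 1) + 6 * B ^ 2) := by positivity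
    have h5 : 1 ≤ 1 + Q ^ 4 / (c * M ^ 2 * N) := le_add_of_nonneg_right (by positivity)
    have h6 : X ≤ X ^ 2 := le_self_pow₀ hX two_ne_zero
    calc (I.card : ℝ) * E ≤ 3 * M * E := by gcongr
      _ = implicitConst C B * (X * M * r * 1) := by rw [hE, implicitConst]; ring
      _ ≤ _ := by
        have : 0 ≤ implicitConst C B := by rw [implicitConst]; positivity
        gcongr

theorem proposition8p1 (ε : ℝ) (hε : 0 < ε) (C : ℕ → ℝ) (B : ℝ) :
    ∃ K : ℝ, ∀ (c : ℝ) (q : ℕ) [NeZero q] (M N Q : ℝ), MemT₂ ε B c q M N Q →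
      ∀ W₁ W₂ : ℝ → ℝ, IsWeight C ((q : ℝ) ^ ε * Q) W₁ → IsWeight C ((q : ℝ) ^ ε * Q) W₂ →
      ∀ a : ℕ, a.Coprime q →
        ‖∑' p : ℤ × ℤ, G c M N W₁ W₂ p.1 p.2 * Kl₂ (a * p.1 * p.2) q‖
            ≤ K * (((q : ℝ) ^ ε * Q) ^ 2 * M * (q : ℝ) ^ (1 / 2 : ℝ) *
                (1 + Q ^ 4 / (c * M ^ 2 * N))) ∧
        ∀ (U : ℝ) (W₃ : ℝ → ℝ), 1 ≤ U → IsWeight C ((q : ℝ) ^ ε * Q) W₃ →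
          ‖∑' p : ℤ × ℤ, H c M N U W₁ W₂ W₃ p.1 p.2 * Kl₂ (a * p.1 * p.2) q‖
            ≤ K * (((q : ℝ) ^ ε * Q) ^ 2 * M * (q : ℝ) ^ (1 / 2 : ℝ) *
                (1 + Q ^ 4 / (c * M ^ 2 * N))) := by
  refine ⟨implicitConst C B, fun c q _ M N Q h W₁ W₂ hW₁ hW₂ a ha => ?_⟩
  have hN0 : 0 < N := by linarith [h.half_le_N]
  have hX : 0 ≤ (q : ℝ) ^ ε * Q := by
    have := h.one_le_Q
    positivity
  refine ⟨?_, fun U W₃ hU hW₃ => ?_⟩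
  · have h1 := norm_tsum_weighted_mul_Kl₂_le hε h hW₁ hW₂ ha (fun _ _ => 1) fun x _ =>
      Or.inr (hasDerivBounds_const_one (one_le_weightConst C) (by positivity))
    simpa only [G, mul_one] using h1
  · refine norm_tsum_weighted_mul_Kl₂_le hε h hW₁ hW₂ ha (fun x y => W₃ (x * y / U)) fun x hx => ?_
    have hU0 : 0 < U := by linarith
    -- Beyond 2/N, the support of `W₂` forces y ≥ 0.95N, so xy/U ≥ 1.9 lies outside the support of
    -- `W₃`.
    rcases le_or_gt (x / U) (2 / N) with hk | hk
    · right
      have h1 := (hW₃.hasDerivBounds_comp_mul hX (k := x / U) (by positivity)).mono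
        (Y' := 2 * ((q : ℝ) ^ ε * Q / N)) (by positivity) ((mul_le_mul_of_nonneg_left hk hX).trans_eq
          (by ring))
      simpa only [div_mul_eq_mul_div] using h1
    · left
      intro y
      by_cases hy : y / N ∈ Set.Icc (0.95 : ℝ) 1.05
      · rw [hW₃.eq_zero_of_notMem, mul_zero]
        rintro ⟨-, h2⟩
        have hy1 := (le_div_iff₀ hN0).1 hy.1
        have h3 : 2 / N * (0.95 * N) ≤ x / U * y := by gcongr
        have h4 : 2 / N * (0.95 * N) = 1.9 := by
          field_simp
          norm_num
        rw [h4, div_mul_eq_mul_div] at h3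
        linarith
      · rw [hW₂.eq_zero_of_notMem hy, zero_mul]
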